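/- All DFAs are complete: $\mathcal A=(Q,\Sigma,q_I,\delta,F)$ with $Q$ a finite set of states, $\Sigma$ a finite non-empty alphabet, $q_I\in Q$, $\delta:Q\times\Sigma\to Q$ (extended to words as usual) and $F\subseteq Q$; $|\mathcal A|=|Q|$, and $L(\mathcal A)$ is the recognized language. $\mathcal A$ is minimal if no DFA with fewer states recognizes $L(\mathcal A)$; the index $\mathrm{ind}(\mathcal A)$ is the least size of a DFA recognizing $L(\mathcal A)$. $\mathcal A$ is acyclic if every state $q$ with $\delta(q,w)=q$ for some non-empty word $w$ is a rejecting sink (that is, $q\notin F$ and $\delta(q,\sigma)=q$ for all $\sigma\in\Sigma$). $\mathcal A$ is linear if for any two distinct states exactly one is reachable from the other. $\mathcal A$ is a safety DFA if $w\notin L(\mathcal A)$ implies $wy\notin L(\mathcal A)$ for all $y\in\Sigma^*$. A compression of a word $w=\sigma_1\cdots\sigma_n$ is a word $\sigma_1\cdots\sigma_i\sigma_{i+l}\cdots\sigma_n$ with $i\in\{0,\dots,n-2\}$ and $l\in\{2,\dots,n-i\}$; an extension of $w$ is a word $wv$ with $v\in\Sigma^+$. An acyclic DFA $\mathcal A$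 has the compression-extension property (CEP) if every $w\in L(\mathcal A)$ with $|w|=n$, where $n$ is the length of the longest word in $L(\mathcal A)$, has a compression all of whose extensions are rejected by $\mathcal A$. $\mathcal A$ is $\cap$-composite if there are $t\ge 1$ and DFAs $\mathcal A_1,\dots,\mathcal A_t$ over $\Sigma$ with $L(\mathcal A)=\bigcap_{i=1}^t L(\mathcal A_i)$ and $|\mathcal A_i|<\mathrm{ind}(\mathcal A)$ for all $i$; otherwise $\mathcal A$ is $\cap$-prime. **Theorem.** Let $\mathcal A$ be a minimal acyclic DFA with $L(\mathcal A)\neq\emptyset$. Then $L(\mathcal A)$ has a longest word; let $n\in\mathbb N$ be its length. The DFA $\mathcal A$ is $\cap$-prime if and only if $\mathcal A$ is linear and (i) $\sigma^n\in L(\mathcal A)$ for some $\sigma\in\Sigma$, or (ii) $\mathcal A$ is a safety DFA and $\mathcal A$ does not have the CEP. -/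

import Mathlib

namespace DFA

universe u v

/-- Every DFA with finitely many states (in any universe) recognizes the same language as a DFA with
the same number of states whose state set is some `Fin m`.  Hence quantifying over all finite DFAs,
up to language and size, is the same as quantifying over the DFAs with state set `Fin m`. -/
theorem exists_fin_accepts_eq {α : Type u} {Q : Type v} [Fintype Q] (A : DFA α Q) :
    ∃ B : DFA α (Fin (Fintype.card Q)), B.accepts = A.accepts :=
  ⟨DFA.reindex (Fintype.equivFin Q) A, DFA.accepts_reindex A (Fintype.equivFin Q)⟩

/-- The index of a language: the least size of a DFA recognizing it. -/
noncomputable def index {α : Type u} (L : Language α) : ℕ :=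
  sInf {m : ℕ | ∃ B : DFA α (Fin m), B.accepts = L}

/-- `A` is minimal: no DFA with strictly fewer states recognizes the language of `A`. -/
def IsMinimal {α : Type u} {Q : Type v} [Fintype Q] (A : DFA α Q) : Prop :=
  ∀ (m : ℕ) (B : DFA α (Fin m)), m < Fintype.card Q → B.accepts ≠ A.accepts

/-- The state `q'` is reachable from the state `q`. -/
def ReachableFrom {α : Type u} {Q : Type v} (A : DFA α Q) (q q' : Q) : Prop :=
  ∃ w : List α, A.evalFrom q w = q'

/-- A sink is a state that is never left. -/
def IsSink {α : Type u} {Q : Type v} (A : DFA α Q) (q : Q) : Prop :=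
  ∀ a : α, A.step q a = q

/-- `A` is acyclic (an ADFA): every cycle, that is, every path of positive length from a state to
itself, begins in a rejecting sink. -/
def IsAcyclic {α : Type u} {Q : Type v} (A : DFA α Q) : Prop :=
  ∀ (q : Q) (w : List α), w ≠ [] → A.evalFrom q w = q → A.IsSink q ∧ q ∉ A.accept

/-- `A` is linear: of any two distinct states, exactly one is reachable from the other. -/
def IsLinear {α : Type u} {Q : Type v} (A : DFA α Q) : Prop :=
  ∀ q q' : Q, q ≠ q' → Xor (A.ReachableFrom q q') (A.ReachableFrom q' q)

/-- `n` is the length of the longest word accepted by `A`. -/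
def IsLongestLength {α : Type u} {Q : Type v} (A : DFA α Q) (n : ℕ) : Prop :=
  IsGreatest {m : ℕ | ∃ w : List α, w ∈ A.accepts ∧ w.length = m} n

/-- `w'` is a compression of `w = σ₁ … σₙ`: it is `σ₁ … σᵢ σᵢ₊ₗ … σₙ` with `0 ≤ i ≤ n - 2` and
`2 ≤ l ≤ n - i`.  The letters `σᵢ₊₁, …, σᵢ₊ₗ₋₁` are removed: at least one, and never the
last letter of `w`. (The bound `i ≤ n - 2` follows from the bounds on `l`.) -/
def IsCompression {α : Type u} (w w' : List α) : Prop :=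
  ∃ i l : ℕ, 2 ≤ l ∧ i + l ≤ w.length ∧ w' = w.take i ++ w.drop (i + l - 1)

/-- The compression-extension property: every accepted word of maximal length `n` has a compression
all of whose extensions (by at least one letter) are rejected. -/
def HasCEP {α : Type u} {Q : Type v} (A : DFA α Q) : Prop :=
  ∀ n : ℕ, A.IsLongestLength n → ∀ w : List α, w ∈ A.accepts → w.length = n →
    ∃ w' : List α, IsCompression w w' ∧ ∀ v : List α, v ≠ [] → w' ++ v ∉ A.accepts

/-- `A` is a safety DFA: every continuation of a rejected word is rejected. -/
def IsSafety {α : Type u} {Q : Type v} (A : DFA α Q) : Prop :=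
  ∀ w : List α, w ∉ A.accepts → ∀ y : List α, w ++ y ∉ A.accepts

/-- `A` is `k`-decomposable: its language is the intersection of the languages of `t ≥ 1` DFAs over
the same alphabet, each with at most `k` states. -/
def IsDecomposable {α : Type u} {Q : Type v} (A : DFA α Q) (k : ℕ) : Prop :=
  ∃ (t : ℕ) (s : Fin t → ℕ) (B : ∀ i : Fin t, DFA α (Fin (s i))),
    1 ≤ t ∧ (∀ i, s i ≤ k) ∧ ∀ w : List α, w ∈ A.accepts ↔ ∀ i, w ∈ (B i).accepts

/-- `A` is `∩`-composite: `k`-decomposable for some `k ≥ 1` below the index of its language. -/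
def IsComposite {α : Type u} {Q : Type v} (A : DFA α Q) : Prop :=
  ∃ k : ℕ, 1 ≤ k ∧ k < index A.accepts ∧ A.IsDecomposable k

/-- `A` is `∩`-prime: it is not `∩`-composite. -/
def IsPrime {α : Type u} {Q : Type v} (A : DFA α Q) : Prop :=
  ¬ A.IsComposite

end DFA

/-! Over a finite alphabet only finitely many DFAs have at most `k` states, so a language is an
intersection of such DFAs iff each rejected word is rejected by one of them that accepts the whole
language (`Separable`). A longest word runs through `n + 1` distinct live states and one more letter
reaches another state, so there are at least `n + 2` states; for a minimal DFA, equality means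
linearity. If there are more, separators with `n + 2` states always exist, and the DFA is composite.
If there are exactly `n + 2`, the DFA is a ladder and separators may have only `n + 1` states. Words
shorter than `n`, or with a rejected subsequence of length `n`, are easy. For the remaining long
words, the CEP allows two ladder states to be merged (`separable_of_isCompression`), while a
rejecting state below `n`, if no `σⁿ` is accepted, can be hit by counting a suitable letter
(`separable_of_forall_sublist`). Primality is a pigeonhole argument: long powers of `σ` are
inseparable if `σⁿ` is accepted (`not_separable_replicate`), and in a safety DFA so is `wcc` if `wc`
is a longest word violating the CEP (`not_separable_of_isCompression`). -/

namespace DFA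

universe u v

/-! ### Reduction of decomposability to separating single words -/

/-- A DFA all of whose runs stay in a finite set `T` of states is equivalent to one with `#T`
states. -/
theorem exists_fin_of_closed {α : Type u} {S : Type v} (B : DFA α S) (T : Finset S)
    (h0 : B.start ∈ T) (hT : ∀ q ∈ T, ∀ a, B.step q a ∈ T) :
    ∃ C : DFA α (Fin T.card), C.accepts = B.accepts := by
  let C : DFA α T :=
    { step := fun q a => ⟨B.step q a, hT q q.2 a⟩
      start := ⟨B.start, h0⟩
      accept := {q | (q : S) ∈ B.accept} }
  have hC : ∀ (w : List α) (q : T), (C.evalFrom q w : S) = B.evalFrom q w := by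
    intro w
    induction w with
    | nil => intro q; rfl
    | cons a w ih => intro q; simpa [DFA.evalFrom_cons] using ih (C.step q a)
  have hD := exists_fin_accepts_eq C
  rw [Fintype.card_coe] at hD
  obtain ⟨D, hD⟩ := hD
  refine ⟨D, hD.trans ?_⟩
  ext w
  rw [mem_accepts, mem_accepts]
  change (C.evalFrom C.start w : S) ∈ B.accept ↔ _
  rw [hC]
  rfl

/-- Some DFA with at most `k` states accepts every word of `L` but rejects `u`. -/
def Separable {α : Type u} (L : Language α) (k : ℕ) (u : List α) : Prop :=
  ∃ m ≤ k, ∃ B : DFA α (Fin m), (∀ w ∈ L, w ∈ B.accepts) ∧ u ∉ B.accepts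

/-- Separators can thus be written over a convenient infinite type such as `ℕ` or `List α`; only a
closed finite set of states is counted. -/
theorem separable_of_closed {α : Type u} {S : Type v} {L : Language α} {k : ℕ} {u : List α}
    (B : DFA α S) (T : Finset S) (h0 : B.start ∈ T) (hT : ∀ q ∈ T, ∀ a, B.step q a ∈ T)
    (hk : T.card ≤ k) (hL : ∀ w ∈ L, B.eval w ∈ B.accept) (hu : B.eval u ∉ B.accept) :
    Separable L k u := by
  obtain ⟨C, hC⟩ := exists_fin_of_closed B T h0 hT
  exact ⟨T.card, hk, C, fun w hw => hC ▸ hL w hw, hC ▸ hu⟩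

theorem finite_dfa (α : Type u) (S : Type v) [Finite α] [Finite S] : Finite (DFA α S) := by
  apply Finite.of_injective
    (fun B : DFA α S => ((B.step, B.start, B.accept) : (S → α → S) × S × Set S))
  rintro ⟨s, q, F⟩ ⟨s', q', F'⟩ h
  simp only [Prod.mk.injEq] at h
  obtain ⟨rfl, rfl, rfl⟩ := h
  rfl

/-- Intersect all of the finitely many DFAs with at most `k` states that accept every word of the
language. The one-state DFA accepting everything ensures that there is at least one factor. -/
theorem isDecomposable_of_separable {α : Type u} {Q : Type v} [Finite α] (A : DFA α Q) {k : ℕ}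
    (hk : 1 ≤ k) (h : ∀ u, u ∉ A.accepts → Separable A.accepts k u) : A.IsDecomposable k := by
  have hfin : ∀ S : Type, [Finite S] → Finite (DFA α S) := fun S _ => finite_dfa α S
  let T := {P : (m : Fin (k + 1)) × DFA α (Fin m) // ∀ w ∈ A.accepts, w ∈ P.2.accepts}
  have : Finite T := inferInstance
  have hne : Nonempty T :=
    ⟨⟨⟨⟨1, by omega⟩, ⟨fun q _ => q, 0, Set.univ⟩⟩, fun w _ => Set.mem_univ _⟩⟩
  obtain ⟨t, ⟨e⟩⟩ := Finite.exists_equiv_fin T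
  refine ⟨t, fun i => (e.symm i).1.1, fun i => (e.symm i).1.2, ?_, fun i => ?_, fun w => ?_⟩
  · obtain ⟨x⟩ := hne
    exact (e x).pos
  · exact Nat.lt_succ_iff.1 (e.symm i).1.1.2
  · refine ⟨fun hw i => (e.symm i).2 w hw, fun hw => ?_⟩
    by_contra hA
    obtain ⟨m, hm, B, hB, hu⟩ := h w hA
    have := hw (e ⟨⟨⟨m, by omega⟩, B⟩, hB⟩)
    beta_reduce at this
    rw [Equiv.symm_apply_apply] at this
    exact hu this

/-! ### Separators for subsequences and for single words -/

open Classical in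
/-- The states are the remaining parts of a pattern; reading the first letter of the remaining part
removes it.  A word is rejected once it contains the pattern as a subsequence. -/
noncomputable def subsequenceDFA {α : Type u} (p : List α) : DFA α (List α) where
  step
    | [], _ => []
    | x :: l, y => if y = x then l else x :: l
  start := p
  accept := {l | l ≠ []}

theorem subsequenceDFA_evalFrom_eq_nil_iff {α : Type u} (p : List α) (v l : List α) :
    (subsequenceDFA p).evalFrom l v = [] ↔ l.Sublist v := by
  induction v generalizing l with
  | nil => simp
  | cons y v ih =>
    rw [evalFrom_cons, ih]
    cases l with
    | nil => simp [subsequenceDFA]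
    | cons x l =>
      by_cases h : y = x
      · subst h
        simp [subsequenceDFA]
      · simp only [subsequenceDFA, if_neg h]
        constructor
        · exact fun h' => h'.cons y
        · intro h'
          cases h' with
          | cons _ h' => exact h'
          | cons_cons _ h' => exact absurd rfl h

theorem separable_of_sublist {α : Type u} {L : Language α} {p u : List α} {k : ℕ}
    (hk : p.length + 1 ≤ k) (hL : ∀ w ∈ L, ¬ p.Sublist w) (hu : p.Sublist u) :
    Separable L k u := by
  classical
  refine separable_of_closed (subsequenceDFA p) p.tails.toFinset ?_ ?_ ?_ ?_ ?_
  · simp [subsequenceDFA]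
  · intro l hl a
    rw [List.mem_toFinset, List.mem_tails] at hl ⊢
    cases l with
    | nil => exact hl
    | cons x l =>
      simp only [subsequenceDFA]
      split_ifs
      · exact (List.suffix_cons x l).trans hl
      · exact hl
  · exact (List.toFinset_card_le _).trans (by simpa using hk)
  · exact fun w hw h => hL w hw ((subsequenceDFA_evalFrom_eq_nil_iff p w p).1 h)
  · exact fun h => h ((subsequenceDFA_evalFrom_eq_nil_iff p u p).2 hu)

open Classical in
/-- The DFA that rejects exactly the word `p`. -/
noncomputable def exceptDFA {α : Type u} (p : List α) : DFA α (Option (List α)) where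
  step
    | some (x :: l), y => if y = x then some l else none
    | _, _ => none
  start := some p
  accept := {q | q ≠ some []}

theorem exceptDFA_evalFrom_none {α : Type u} (p v : List α) :
    (exceptDFA p).evalFrom none v = none := by
  induction v with
  | nil => rfl
  | cons y v ih => exact ih

theorem exceptDFA_evalFrom_eq_iff {α : Type u} (p v l : List α) :
    (exceptDFA p).evalFrom (some l) v = some [] ↔ v = l := by
  induction v generalizing l with
  | nil => simp [eq_comm]
  | cons y v ih =>
    rw [evalFrom_cons]
    cases l with
    | nil =>
      have : (exceptDFA p).step (some []) y = none := rfl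
      rw [this, exceptDFA_evalFrom_none]
      simp
    | cons x l =>
      by_cases h : y = x
      · have : (exceptDFA p).step (some (x :: l)) y = some l := if_pos h
        rw [this, ih]
        simp [h]
      · have : (exceptDFA p).step (some (x :: l)) y = none := if_neg h
        rw [this, exceptDFA_evalFrom_none]
        simp [h]

/-- The states are the `u.length + 1` suffixes of `u` and the trap `none`. -/
theorem separable_of_length_le {α : Type u} {L : Language α} {u : List α} {k : ℕ}
    (hk : u.length + 2 ≤ k) (hu : u ∉ L) : Separable L k u := by
  classical
  refine separable_of_closed (exceptDFA u) (insert none (u.tails.toFinset.image some)) ?_ ?_ ?_ ?_ ?_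
  · simp [exceptDFA]
  · intro q hq a
    rcases q with _ | _ | ⟨x, l⟩
    · simp [exceptDFA]
    · simp [exceptDFA]
    · simp only [exceptDFA]
      split_ifs
      · simp only [Finset.mem_insert, reduceCtorEq, Finset.mem_image, List.mem_toFinset,
          List.mem_tails, Option.some.injEq, exists_eq_right, false_or] at hq ⊢
        exact (List.suffix_cons x l).trans hq
      · simp
  · refine (Finset.card_insert_le _ _).trans ?_
    have := Finset.card_image_le (s := u.tails.toFinset) (f := some)
    have := u.tails.toFinset_card_le
    rw [List.length_tails] at this
    omega
  · intro w hw h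
    exact hu ((exceptDFA_evalFrom_eq_iff u w u).1 h ▸ hw)
  · exact fun h => h ((exceptDFA_evalFrom_eq_iff u u u).2 rfl)

/-! ### Ladders -/

/-- A DFA on `{0, …, n + 1}` that climbs with every letter until it reaches the rejecting sink
`n + 1`, with `n` accepting. -/
structure IsLadder {α : Type u} (M : DFA α ℕ) (n : ℕ) : Prop where
  start_eq : M.start = 0
  lt_step : ∀ t ≤ n, ∀ y, t < M.step t y
  step_le : ∀ t y, M.step t y ≤ n + 1
  step_sink : ∀ y, M.step (n + 1) y = n + 1
  mem_accept : n ∈ M.accept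
  sink_notMem : n + 1 ∉ M.accept

namespace IsLadder

variable {α : Type u} {M : DFA α ℕ} {n : ℕ}

theorem evalFrom_le (h : M.IsLadder n) {t : ℕ} (ht : t ≤ n + 1) (v : List α) :
    M.evalFrom t v ≤ n + 1 := by
  induction v generalizing t with
  | nil => exact ht
  | cons y v ih => exact ih (h.step_le t y)

theorem eval_le (h : M.IsLadder n) (v : List α) : M.eval v ≤ n + 1 :=
  h.evalFrom_le (by rw [h.start_eq]; omega) v

theorem evalFrom_sink (h : M.IsLadder n) (v : List α) : M.evalFrom (n + 1) v = n + 1 := by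
  induction v with
  | nil => rfl
  | cons y v ih => rw [evalFrom_cons, h.step_sink, ih]

/-- Each letter climbs at least one rung as long as the sink is avoided. -/
theorem add_length_le (h : M.IsLadder n) {t : ℕ} {v : List α} (ht : t ≤ n + 1)
    (hv : M.evalFrom t v ≤ n) : t + v.length ≤ M.evalFrom t v := by
  induction v generalizing t with
  | nil => simp
  | cons y v ih =>
    rw [evalFrom_cons] at hv ⊢
    have := ih (h.step_le t y) hv
    rcases Nat.lt_or_ge n t with htn | htn
    · obtain rfl : t = n + 1 := by omega
      rw [h.step_sink, h.evalFrom_sink] at hv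
      omega
    · have := h.lt_step t htn y
      simp only [List.length_cons]
      omega

theorem eval_le_of_mem (h : M.IsLadder n) {v : List α} (hv : v ∈ M.accepts) : M.eval v ≤ n := by
  have h1 := h.eval_le v
  rcases Nat.lt_or_ge n (M.eval v) with h2 | h2
  · have h3 : M.eval v = n + 1 := by omega
    rw [mem_accepts, h3] at hv
    exact absurd hv h.sink_notMem
  · exact h2

theorem length_le_eval (h : M.IsLadder n) {v : List α} (hv : M.eval v ≤ n) :
    v.length ≤ M.eval v := by
  have := h.add_length_le (t := M.start) (by rw [h.start_eq]; omega) hv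
  exact (Nat.le_add_left _ _).trans this

theorem length_le (h : M.IsLadder n) {v : List α} (hv : v ∈ M.accepts) : v.length ≤ n :=
  (h.length_le_eval (h.eval_le_of_mem hv)).trans (h.eval_le_of_mem hv)

theorem eval_append (M : DFA α ℕ) (v w : List α) :
    M.eval (v ++ w) = M.evalFrom (M.eval v) w :=
  M.evalFrom_of_append M.start v w

theorem eval_prefix_le (h : M.IsLadder n) {v w : List α} (hv : M.eval (v ++ w) ≤ n) :
    M.eval v ≤ n := by
  by_contra hlt
  have h3 : M.eval v = n + 1 := by have := h.eval_le v; omega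
  rw [eval_append, h3, h.evalFrom_sink] at hv
  omega

/-- Along an accepted word of maximal length the DFA climbs one step at a time. -/
theorem eval_take (h : M.IsLadder n) {w : List α} (hw : w ∈ M.accepts) (hl : w.length = n)
    {k : ℕ} (hk : k ≤ n) : M.eval (w.take k) = k := by
  have h1 := h.eval_le_of_mem hw
  have h2 : M.eval (w.take k ++ w.drop k) ≤ n := by rwa [List.take_append_drop]
  have h3 := h.length_le_eval (h.eval_prefix_le h2)
  rw [eval_append] at h2
  have h4 := h.add_length_le (h.eval_le _) h2
  rw [List.length_take] at h3
  rw [List.length_drop] at h4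
  omega

theorem step_getElem (h : M.IsLadder n) {w : List α} (hw : w ∈ M.accepts) (hl : w.length = n)
    {k : ℕ} (hk : k < n) : M.step k (w[k]'(hl ▸ hk)) = k + 1 := by
  have h1 := h.eval_take hw hl (k := k + 1) hk
  rw [List.take_add_one, List.getElem?_eq_getElem (hl ▸ hk), Option.toList_some,
    eval_append_singleton, h.eval_take hw hl hk.le] at h1
  exact h1

theorem evalFrom_drop (h : M.IsLadder n) {w : List α} (hw : w ∈ M.accepts) (hl : w.length = n)
    {k : ℕ} (hk : k ≤ n) : M.evalFrom k (w.drop k) = n := by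
  have h1 := h.eval_take hw hl hk
  have h2 := h.eval_take hw hl le_rfl
  rw [List.take_of_length_le hl.le, ← List.take_append_drop k w, eval_append, h1] at h2
  exact h2

/-- If a lagging run catches up with the number of the letters read, then it does so with one
particular letter. -/
theorem exists_step_ge (M : DFA α ℕ) {v : List α} {i j : ℕ} (hij : i < j)
    (hv : j + v.length ≤ M.evalFrom i v) :
    ∃ (k i' : ℕ) (hk : k < v.length), i' < j + k ∧ j + k + 1 ≤ M.step i' v[k] := by
  induction v generalizing i j with
  | nil => simp at hv; omega
  | cons b v ih =>
    by_cases hb : j + 1 ≤ M.step i b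
    · exact ⟨0, i, by simp, by simpa using hij, by simpa using hb⟩
    · obtain ⟨k, i', hk, h1, h2⟩ := ih (i := M.step i b) (j := j + 1) (by omega)
        (by rw [evalFrom_cons, List.length_cons] at hv; omega)
      exact ⟨k + 1, i', by simpa using hk, by omega, by
        simp only [List.getElem_cons_succ]; omega⟩

end IsLadder

/-! ### Merging two states: separators from the CEP -/

open Classical in
/-- The DFA obtained from the ladder `M` on `{0, …, n + 1}` by replacing the state `j` by the smaller
state `i`, which is left for `j + 1` with the letter `b`.  From the states above `i`, every letter
leads to the successor. -/
noncomputable def shortcutDFA {α : Type u} (M : DFA α ℕ) (n i j : ℕ) (b : α) : DFA α ℕ where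
  step m y :=
    if m < i then (if M.step m y = j then i else M.step m y)
    else if m = i ∧ y = b then j + 1
    else if min (m + 1) (n + 1) = j then i else min (m + 1) (n + 1)
  start := 0
  accept := {n + 1}ᶜ

namespace IsLadder

variable {α : Type u} {M : DFA α ℕ} {n : ℕ}

/-- The new DFA never gets ahead of `M` while `M` avoids the sink, so it accepts all words of `M`.
The shortcut from `i` to `j + 1` is harmless: `M` is either at `i`, where `hb` applies, or already
at `j` or beyond. -/
theorem shortcutDFA_invariant (h : M.IsLadder n) {i j : ℕ} (hij : i < j) (hj : j < n) {b : α}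
    (hb : j + 1 ≤ M.step i b) (v : List α) (hv : M.eval v ≤ n) :
    ((shortcutDFA M n i j b).eval v = M.eval v ∧ M.eval v ≤ i) ∨
      ((shortcutDFA M n i j b).eval v = i ∧ j ≤ M.eval v) ∨
      (i < (shortcutDFA M n i j b).eval v ∧
        (shortcutDFA M n i j b).eval v ≤ M.eval v) := by
  induction v using List.reverseRecOn with
  | nil =>
    left
    simp [h.start_eq, shortcutDFA]
  | append_singleton v y ih =>
    have h1 := h.eval_prefix_le hv
    specialize ih h1
    rw [eval_append_singleton] at hv ⊢
    rw [eval_append_singleton]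
    generalize (shortcutDFA M n i j b).eval v = m at ih ⊢
    generalize M.eval v = t at ih h1 hv ⊢
    have h2 := h.lt_step t h1 y
    simp only [shortcutDFA]
    rcases ih with ⟨rfl, ih⟩ | ih
    · rcases ih.lt_or_eq with hm | rfl
      · simp only [hm, if_true]
        split_ifs <;> omega
      · simp only [lt_irrefl, if_false, true_and]
        by_cases hy : y = b
        · subst hy
          simp only [and_self, if_true]
          omega
        · simp only [hy, and_false, if_false]
          split_ifs <;> omega
    · have hm : ¬ m < i := by omega
      simp only [hm, if_false]
      split_ifs <;> omega

/-- Along `w` the state is the number of letters read, with `i` standing in for `j`. As `w[i] ≠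
w[j]`, the shortcut is not taken on the first visit to `i`, but it is taken on the second. -/
theorem shortcutDFA_eval_take (h : M.IsLadder n) {i j : ℕ} (hij : i < j) (hj : j < n)
    {w : List α} (hw : w ∈ M.accepts) (hl : w.length = n)
    (hb : w[i]'(by omega) ≠ w[j]'(by omega)) {k : ℕ} (hk : k ≤ n) :
    (shortcutDFA M n i j (w[j]'(by omega))).eval (w.take k) = if k = j then i else k := by
  induction k with
  | zero =>
    rw [if_neg (by omega)]
    rfl
  | succ k ih =>
    rw [List.take_add_one, List.getElem?_eq_getElem (by omega), Option.toList_some,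
      eval_append_singleton, ih (by omega)]
    have h1 := h.step_getElem hw hl (k := k) (by omega)
    by_cases hkj : k = j
    · subst hkj
      simp [shortcutDFA]
    · simp only [hkj, if_false, shortcutDFA, h1]
      by_cases hki : k = i
      · subst hki
        simp only [lt_irrefl, if_false, true_and, hb]
        split_ifs <;> omega
      · simp only [hki, false_and, if_false]
        split_ifs <;> omega

theorem separable_of_shortcut (h : M.IsLadder n) {i j : ℕ} (hij : i < j) (hj : j < n)
    {w y : List α} (hw : w ∈ M.accepts) (hl : w.length = n)
    (hb : j + 1 ≤ M.step i (w[j]'(by omega))) (hy : y ≠ []) :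
    Separable M.accepts (n + 1) (w ++ y) := by
  have hne : w[i]'(by omega) ≠ w[j]'(by omega) := by
    intro heq
    rw [← heq, h.step_getElem hw hl (by omega)] at hb
    omega
  refine separable_of_closed (shortcutDFA M n i j (w[j]'(by omega)))
    ((Finset.range (n + 2)).erase j) ?_ ?_ ?_ ?_ ?_
  · simp only [shortcutDFA, Finset.mem_erase, Finset.mem_range]
    omega
  · intro m hm a
    simp only [shortcutDFA, Finset.mem_erase, Finset.mem_range] at hm ⊢
    have := h.step_le m a
    split_ifs <;> omega
  · rw [Finset.card_erase_of_mem (by simp; omega), Finset.card_range]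
    omega
  · intro v hv
    have h1 := h.eval_le_of_mem hv
    have h2 := h.shortcutDFA_invariant hij hj hb v h1
    change ¬ _ = _
    omega
  · have hsink : ∀ v : List α,
        (shortcutDFA M n i j (w[j]'(by omega))).evalFrom (n + 1) v = n + 1 := by
      intro v
      induction v with
      | nil => rfl
      | cons a v ih =>
        rw [evalFrom_cons]
        convert ih using 2
        simp only [shortcutDFA]
        rw [if_neg (by omega), if_neg (by omega), if_neg (by omega)]
        omega
    have h1 := h.shortcutDFA_eval_take hij hj hw hl hne le_rfl
    rw [List.take_of_length_le hl.le, if_neg (by omega)] at h1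
    obtain ⟨a, y, rfl⟩ := List.exists_cons_of_ne_nil hy
    have h2 : (shortcutDFA M n i j (w[j]'(by omega))).step n a = n + 1 := by
      simp only [shortcutDFA]
      rw [if_neg (by omega), if_neg (by omega), if_neg (by omega)]
      omega
    rw [eval_append, h1, evalFrom_cons, h2, hsink]
    simp [shortcutDFA]

/-- Words beyond an accepted word `w` of maximal length are separable if `w` has a compression all
of whose extensions are rejected. -/
theorem separable_of_isCompression (h : M.IsLadder n) {w w' y : List α} (hw : w ∈ M.accepts)
    (hl : w.length = n) (hc : IsCompression w w')
    (hv : ∀ v : List α, v ≠ [] → w' ++ v ∉ M.accepts) (hy : y ≠ []) :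
    Separable M.accepts (n + 1) (w ++ y) := by
  obtain ⟨i, l, h2l, hil, rfl⟩ := hc
  -- Otherwise the compression ends in a state `t < n`, and the nonempty word `w.drop t` leads from
  -- there to `n`, giving an accepted extension.
  have hge : n ≤ M.eval (w.take i ++ w.drop (i + l - 1)) := by
    by_contra! hlt
    refine hv (w.drop (M.eval (w.take i ++ w.drop (i + l - 1)))) ?_ ?_
    · intro h0
      rw [List.drop_eq_nil_iff] at h0
      omega
    · rw [mem_accepts, eval_append, h.evalFrom_drop hw hl hlt.le]
      exact h.mem_accept
  rw [eval_append, h.eval_take hw hl (by omega)] at hge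
  -- The deletion makes the run start late, at `i` instead of `i + l - 1`, yet it reaches `n`; the
  -- letter with which it catches up provides the shortcut.
  obtain ⟨k, i', hk, h1, h2⟩ := exists_step_ge M (i := i) (j := i + l - 1)
    (v := w.drop (i + l - 1)) (by omega) (by rw [List.length_drop]; omega)
  rw [List.length_drop] at hk
  rw [List.getElem_drop] at h2
  exact h.separable_of_shortcut h1 (by omega) hw hl h2 hy

end IsLadder

/-! ### Counting a letter: separators for non-safety ladders -/

open Classical in
/-- The DFA on `{0, …, n}` that follows the ladder `M` below the state `s`.  From `s` on it climbs
with every letter below `a` and only with the letter `x` above; from `n` it falls back to `m₀`.  Only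
`s` is rejecting. -/
noncomputable def waitDFA {α : Type u} (M : DFA α ℕ) (n s a m₀ : ℕ) (x : α) : DFA α ℕ where
  step m y :=
    if m < s then (if M.step m y ≤ n then M.step m y else 0)
    else if m < a ∨ y = x then (if m < n then m + 1 else m₀)
    else m
  start := 0
  accept := {s}ᶜ

/-- A sequence of natural numbers that grows by at most one attains all intermediate values. -/
theorem exists_eq_of_succ_le {f : ℕ → ℕ} {lo hi n : ℕ} (hle : lo ≤ hi)
    (hf : ∀ k, lo ≤ k → k < hi → f (k + 1) ≤ f k + 1) (hlo : f lo ≤ n) (hhi : n ≤ f hi) :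
    ∃ k, lo ≤ k ∧ k ≤ hi ∧ f k = n := by
  induction hi, hle using Nat.le_induction with
  | base => exact ⟨lo, le_rfl, le_rfl, le_antisymm hlo hhi⟩
  | succ hi hle ih =>
    rcases Nat.lt_or_ge (f hi) n with hlt | hge
    · exact ⟨hi + 1, by omega, le_rfl, by have := hf hi hle (by omega); omega⟩
    · obtain ⟨k, h1, h2, h3⟩ := ih (fun k h1 h2 => hf k h1 (by omega)) hge
      exact ⟨k, h1, by omega, h3⟩

theorem exists_last {P : ℕ → Prop} (h0 : P 0) (b : ℕ) :
    ∃ e ≤ b, P e ∧ (e = b ∨ ¬ P (e + 1)) := by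
  induction b with
  | zero => exact ⟨0, le_rfl, h0, Or.inl rfl⟩
  | succ b ih =>
    obtain ⟨e, he, hP, rfl | h⟩ := ih
    · by_cases h : P (e + 1)
      · exact ⟨e + 1, le_rfl, h, Or.inl rfl⟩
      · exact ⟨e, by omega, hP, Or.inr h⟩
    · exact ⟨e, by omega, hP, Or.inr h⟩

open Classical in
/-- The number of occurrences of `x` in `u` at the positions in `[a, b)`. -/
noncomputable def countIco {α : Type u} (u : List α) (x : α) (a b : ℕ) : ℕ :=
  ((Finset.Ico a b).filter (fun k => u[k]? = some x)).card

theorem countIco_succ_right {α : Type u} (u : List α) (x : α) {a b : ℕ} (h : a ≤ b)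
    (hb : b < u.length) [Decidable (u[b] = x)] :
    countIco u x a (b + 1) = countIco u x a b + if u[b] = x then 1 else 0 := by
  classical
  simp only [countIco, Finset.card_filter]
  rw [Finset.sum_Ico_succ_top h, List.getElem?_eq_getElem hb]
  simp

theorem countIco_le_sub {α : Type u} (u : List α) (x : α) (a b : ℕ) :
    countIco u x a b ≤ b - a := by
  classical exact (Finset.card_filter_le _ _).trans (Nat.card_Ico _ _).le

theorem countIco_mono_right {α : Type u} (u : List α) (x : α) (a : ℕ) {b c : ℕ} (h : b ≤ c) :
    countIco u x a b ≤ countIco u x a c := by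
  classical exact Finset.card_le_card (Finset.filter_subset_filter _ (Finset.Ico_subset_Ico le_rfl h))

theorem countIco_le_succ_left {α : Type u} (u : List α) (x : α) (a b : ℕ) :
    countIco u x (a + 1) b ≤ countIco u x a b := by
  classical exact Finset.card_le_card (Finset.filter_subset_filter _ (Finset.Ico_subset_Ico (by omega) le_rfl))

namespace IsLadder

variable {α : Type u} {M : DFA α ℕ} {n : ℕ}

theorem le_evalFrom (h : M.IsLadder n) {t : ℕ} (ht : t ≤ n + 1) (v : List α) :
    t ≤ M.evalFrom t v := by
  rcases Nat.lt_or_ge n (M.evalFrom t v) with h1 | h1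
  · omega
  · have := h.add_length_le ht h1
    omega

/-- Hence `s` is reached only when `M` is at `s` too. The fall from `n` to `m₀` does not interfere:
`M` is then at `n` as well and moves to the sink. Nor does the default `0`, used only when `M`
enters the sink. -/
theorem waitDFA_invariant (h : M.IsLadder n) {s a m₀ : ℕ} (hsa : s < a) {x : α}
    (v : List α) (hv : M.eval v ≤ n) :
    ((waitDFA M n s a m₀ x).eval v = M.eval v ∧ M.eval v ≤ s) ∨
      (s < (waitDFA M n s a m₀ x).eval v ∧ (waitDFA M n s a m₀ x).eval v ≤ M.eval v) := by
  induction v using List.reverseRecOn with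
  | nil =>
    left
    simp [h.start_eq, waitDFA]
  | append_singleton v y ih =>
    have h1 := h.eval_prefix_le hv
    specialize ih h1
    rw [eval_append_singleton] at hv ⊢
    rw [eval_append_singleton]
    generalize (waitDFA M n s a m₀ x).eval v = m at ih ⊢
    generalize M.eval v = t at ih h1 hv ⊢
    have h2 := h.lt_step t h1 y
    simp only [waitDFA]
    rcases ih with ⟨rfl, ih⟩ | ih
    · rcases ih.lt_or_eq with hm | rfl
      · rw [if_pos hm, if_pos hv]
        omega
      · rw [if_neg (lt_irrefl _), if_pos (Or.inl hsa), if_pos (by omega)]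
        omega
    · rw [if_neg (by omega)]
      have : m < n := by omega
      simp only [this, if_true]
      split_ifs <;> omega

theorem waitDFA_evalFrom (h : M.IsLadder n) {s a m₀ : ℕ} (hsn : s < n) {x : α} {m : ℕ}
    {v : List α} (hm : m ≤ s) (hv : M.evalFrom m v = s) :
    (waitDFA M n s a m₀ x).evalFrom m v = s := by
  induction v generalizing m with
  | nil => exact hv
  | cons y v ih =>
    rw [evalFrom_cons] at hv
    have h1 := h.le_evalFrom (h.step_le m y) v
    have h2 := h.lt_step m (by omega) y
    have h3 : (waitDFA M n s a m₀ x).step m y = M.step m y := by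
      simp only [waitDFA]
      rw [if_pos (by omega), if_pos (by omega)]
    rw [evalFrom_cons, h3]
    exact ih (by omega) hv

/-- On `u` the state is the position up to `a`; then occurrences of `u[p]` are counted, so that `n`
is reached just before position `p`. The letter `u[p]` resets to `m₀`, and the rest of `u` leads to
the rejecting state `s`. -/
theorem separable_of_wait (h : M.IsLadder n) {s a m₀ p : ℕ} (hs : s ∉ M.accept) (hsn : s < n)
    (hsa : s < a) (hm₀ : m₀ ≤ s) {u : List α} (hp : p < u.length) (hap : a ≤ p)
    (htake : ∀ k ≤ s, M.eval (u.take k) = k) (hcount : a + countIco u u[p] a p = n)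
    (hdrop : M.evalFrom m₀ (u.drop (p + 1)) = s) :
    Separable M.accepts (n + 1) u := by
  classical
  refine separable_of_closed (waitDFA M n s a m₀ u[p]) (Finset.range (n + 1)) ?_ ?_ ?_ ?_ ?_
  · simp [waitDFA]
  · intro m hm y
    simp only [waitDFA, Finset.mem_range] at hm ⊢
    split_ifs <;> omega
  · simp
  · intro v hv
    have h1 := h.eval_le_of_mem hv
    have h2 := h.waitDFA_invariant (m₀ := m₀) hsa (x := u[p]) v h1
    intro (h3 : _ = s)
    rw [h3] at h2
    rcases h2 with ⟨h2, -⟩ | h2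
    · rw [mem_accepts, ← h2] at hv
      exact hs hv
    · omega
  · set B := waitDFA M n s a m₀ u[p] with hB
    have hstep : ∀ k (hk : k < u.length), B.eval (u.take (k + 1)) =
        B.step (B.eval (u.take k)) u[k] := by
      intro k hk
      rw [List.take_add_one, List.getElem?_eq_getElem hk, Option.toList_some,
        eval_append_singleton]
    have hstepM : ∀ k (hk : k < u.length), M.eval (u.take (k + 1)) =
        M.step (M.eval (u.take k)) u[k] := by
      intro k hk
      rw [List.take_add_one, List.getElem?_eq_getElem hk, Option.toList_some,
        eval_append_singleton]
    have h1 : ∀ k ≤ a, B.eval (u.take k) = k := by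
      intro k hk
      induction k with
      | zero => rfl
      | succ k ih =>
        rw [hstep k (by omega), ih (by omega)]
        by_cases hks : k < s
        · have h2 := hstepM k (by omega)
          rw [htake k (by omega), htake (k + 1) (by omega)] at h2
          simp only [hB, waitDFA, hks, if_true, ← h2]
          rw [if_pos (by omega)]
        · simp only [hB, waitDFA]
          rw [if_neg hks, if_pos (Or.inl (by omega)), if_pos (by omega)]
    have h2 : ∀ k, a ≤ k → k ≤ p → B.eval (u.take k) = a + countIco u u[p] a k := by
      intro k hak hkp
      induction k, hak using Nat.le_induction with
      | base => simp [h1 a le_rfl, countIco]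
      | succ k hak ih =>
        have h3 := countIco_mono_right u u[p] a hkp
        have h4 := countIco_succ_right u u[p] hak (by omega)
        rw [hstep k (by omega), ih (by omega), h4]
        simp only [hB, waitDFA]
        rw [if_neg (by omega)]
        by_cases hx : u[k] = u[p]
        · rw [if_pos hx] at h4
          rw [if_pos (Or.inr hx), if_pos (by omega), if_pos hx]
          omega
        · rw [if_neg (by simp only [hx, or_false]; omega), if_neg hx]
          omega
    have h3 : B.eval (u.take (p + 1)) = m₀ := by
      rw [hstep p hp, h2 p hap le_rfl, hcount]
      simp only [hB, waitDFA]
      rw [if_neg (by omega), if_pos (Or.inr trivial), if_neg (by omega)]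
    have h4 : B.eval u = s := by
      rw [← List.take_append_drop (p + 1) u, eval_append, h3]
      exact h.waitDFA_evalFrom hsn hm₀ hdrop
    rw [h4]
    simp [hB, waitDFA]

/-- If all subsequences of length `n` are accepted, then every letter occurring in a certain range
leads from `m` to `m + 1`. -/
theorem step_eq_of_forall_sublist (h : M.IsLadder n) {u : List α}
    (hsub : ∀ p : List α, p.Sublist u → p.length = n → p ∈ M.accepts) {m k : ℕ} (hm : m < n)
    (hmk : m ≤ k) (hk : k + n ≤ m + u.length) : M.step m (u[k]'(by omega)) = m + 1 := by
  -- This subsequence of `u` has `u[k]` at position `m`, where a longest word must climb exactly one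
  -- rung.
  have hl : (u.take m ++ (u.drop k).take (n - m)).length = n := by
    simp only [List.length_append, List.length_take, List.length_drop]
    omega
  have hs : (u.take m ++ (u.drop k).take (n - m)).Sublist u := by
    have h1 := ((List.take_prefix_take_left (l := u) hmk).sublist).append
      (List.take_sublist (n - m) (u.drop k))
    rwa [List.take_append_drop] at h1
  have h2 := h.step_getElem (hsub _ hs hl) hl hm
  rw [List.getElem_append_right (by simp)] at h2
  simp only [List.length_take, List.getElem_take, List.getElem_drop] at h2
  have h3 : k + (m - min m u.length) = k := by omega
  simpa only [h3] using h2

theorem countIco_le_of_forall_ne {u : List α} {x : α} {a b c d : ℕ}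
    (hne : ∀ k, c ≤ k → k < d → u[k]? ≠ some x) :
    countIco u x a b ≤ (c - a) + (b - d) := by
  classical
  have h1 : (Finset.Ico a b).filter (fun k => u[k]? = some x) ⊆
      Finset.Ico a c ∪ Finset.Ico d b := by
    intro k hk
    simp only [Finset.mem_filter, Finset.mem_Ico, Finset.mem_union] at hk ⊢
    by_contra hcon
    exact hne k (by omega) (by omega) hk.2
  have h2 := (Finset.card_le_card h1).trans (Finset.card_union_le _ _)
  rw [Nat.card_Ico, Nat.card_Ico] at h2
  unfold countIco
  convert h2

/-- The last `e` letters of `u` lead from `s - e` to `s`, and `e` cannot be increased within its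
bound. The letter `x` before them is counted. A letter that somewhere fails to climb exactly one
rung is missing from `u.length - n + 1` consecutive positions, so `x` is rare enough for the count
to be tuned to `n`. -/
theorem separable_of_forall_sublist (h : M.IsLadder n) {s : ℕ} (hs : s ∉ M.accept) (hsn : s < n)
    (hpow : ∀ x : α, List.replicate n x ∉ M.accepts) {u : List α} (hu : n < u.length)
    (hsub : ∀ p : List α, p.Sublist u → p.length = n → p ∈ M.accepts) :
    Separable M.accepts (n + 1) u := by
  obtain ⟨e, he, hgood, hlast⟩ := exists_last
    (P := fun e => M.evalFrom (s - e) (u.drop (u.length - e)) = s) (by simp)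
    (min (u.length - n - 1) s)
  have hp : u.length - e - 1 < u.length := by omega
  set p := u.length - e - 1 with hpdef
  have hpow' : ∃ m < n, M.step m u[p] ≠ m + 1 := by
    by_contra! hcon
    have h1 : ∀ k ≤ n, M.eval (List.replicate k u[p]) = k := by
      intro k hk
      induction k with
      | zero => exact h.start_eq
      | succ k ih =>
        rw [List.replicate_succ', eval_append_singleton, ih (by omega), hcon k (by omega)]
    refine hpow u[p] ?_
    rw [mem_accepts, h1 n le_rfl]
    exact h.mem_accept
  have hne : ∀ m < n, M.step m u[p] ≠ m + 1 →
      ∀ k, m ≤ k → k < m + (u.length - n) + 1 → u[k]? ≠ some u[p] := by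
    intro m hm hstep k hmk hk heq
    have h1 := h.step_eq_of_forall_sublist hsub hm hmk (by omega)
    rw [List.getElem?_eq_getElem (by omega), Option.some.injEq] at heq
    rw [heq] at h1
    exact hstep h1
  -- If `e = u.length - n - 1`, then `p = n` and the bound is trivial. If `e = s`, the power
  -- condition yields a rung where `x` fails; otherwise the choice of `e` makes it fail at `s - (e +
  -- 1)`.
  have hcount : s + 1 + countIco u u[p] (s + 1) p ≤ n := by
    by_cases hen : e = u.length - n - 1
    · have h1 := countIco_le_sub u u[p] (s + 1) p
      omega
    by_cases hes : e = s
    · obtain ⟨m, hm, hstep⟩ := hpow'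
      have h1 := countIco_le_of_forall_ne (a := s + 1) (b := p) (hne m hm hstep)
      omega
    · have hstep : M.step (s - (e + 1)) u[p] ≠ s - (e + 1) + 1 := by
        intro hstep
        rcases hlast with h1 | h1
        · omega
        · refine h1 ?_
          have h2 : u.length - (e + 1) = p := by omega
          have h3 : p + 1 = u.length - e := by omega
          have h4 : s - (e + 1) + 1 = s - e := by omega
          rw [h2, List.drop_eq_getElem_cons hp, evalFrom_cons, hstep, h3, h4]
          exact hgood
      have h1 := countIco_le_of_forall_ne (a := s + 1) (b := p)
        (hne (s - (e + 1)) (by omega) hstep)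
      omega
  -- Discrete intermediate value: the sum is at most `n` at `s + 1`, equals `p ≥ n` at `p`, and
  -- rises by at most one per step.
  obtain ⟨a, ha, hap, hcount⟩ := exists_eq_of_succ_le
    (f := fun a => a + countIco u u[p] a p) (lo := s + 1) (hi := p) (n := n) (by omega)
    (fun k _ _ => by
      have := countIco_le_succ_left u u[p] k p
      omega) hcount (by omega)
  have htake : (u.take n).length = n := by
    rw [List.length_take]
    omega
  refine h.separable_of_wait hs hsn (a := a) (m₀ := s - e) (by omega) (by omega) hp hap ?_
    hcount ?_
  · intro k hk
    have h1 := h.eval_take (hsub _ (List.take_sublist n u) htake) htake (k := k) (by omega)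
    rwa [List.take_take, min_eq_left (by omega)] at h1
  · have h3 : p + 1 = u.length - e := by omega
    rw [h3]
    exact hgood

end IsLadder

/-! ### Inseparability of long powers -/

theorem separable_of_isDecomposable {α : Type u} {Q : Type v} {A : DFA α Q} {k : ℕ}
    (h : A.IsDecomposable k) {u : List α} (hu : u ∉ A.accepts) : Separable A.accepts k u := by
  obtain ⟨t, s, B, -, hs, hB⟩ := h
  rw [hB] at hu
  push Not at hu
  obtain ⟨i, hi⟩ := hu
  exact ⟨s i, hs i, B i, fun w hw => (hB w).1 hw i, hi⟩

theorem Separable.mono {α : Type u} {L : Language α} {k l : ℕ} (hkl : k ≤ l) {u : List α}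
    (h : Separable L k u) : Separable L l u := by
  obtain ⟨m, hm, B, hB⟩ := h
  exact ⟨m, hm.trans hkl, B, hB⟩

theorem evalFrom_append {α : Type u} {Q : Type v} (A : DFA α Q) (q : Q) (v w : List α) :
    A.evalFrom q (v ++ w) = A.evalFrom (A.evalFrom q v) w :=
  A.evalFrom_of_append q v w

/-- A DFA with at most `n + 1` states that accepts `xⁿ` also accepts longer powers of `x`. -/
theorem not_separable_replicate {α : Type u} {L : Language α} {n : ℕ} {x : α}
    (hx : List.replicate n x ∈ L) :
    ¬ Separable L (n + 1) (List.replicate (n + (n + 1).factorial) x) := by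
  rintro ⟨m, hm, B, hB, hu⟩
  obtain ⟨i, j, hij, heq⟩ : ∃ i j : Fin (n + 2), i < j ∧
      B.eval (List.replicate i x) = B.eval (List.replicate j x) := by
    obtain ⟨i, j, hij, heq⟩ := Fintype.exists_ne_map_eq_of_card_lt
      (fun i : Fin (n + 2) => B.eval (List.replicate i x)) (by simp; omega)
    rcases lt_or_gt_of_ne hij with h | h
    · exact ⟨i, j, h, heq⟩
    · exact ⟨j, i, h, heq.symm⟩
  have hi : (i : ℕ) < j := hij
  have hj := j.2
  have hadd : ∀ k l : ℕ, B.eval (List.replicate (k + l) x) =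
      B.evalFrom (B.eval (List.replicate k x)) (List.replicate l x) := by
    intro k l
    rw [List.replicate_add]
    exact evalFrom_append _ _ _ _
  have hcycle : ∀ c : ℕ, B.eval (List.replicate (n + ((j : ℕ) - i) * c) x) =
      B.eval (List.replicate n x) := by
    intro c
    induction c with
    | zero => rfl
    | succ c ih =>
      rw [← ih, show n + ((j : ℕ) - i) * (c + 1) = j + (n + ((j : ℕ) - i) * c - i) by
        rw [Nat.mul_succ]; omega, hadd, ← heq, ← hadd]
      congr 2
      omega
  -- The period `j - i` is at most `n + 1`, and `i ≤ n`, so `xⁿ` already lies on the cycle.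
  obtain ⟨c, hc⟩ := Nat.dvd_factorial (m := (j : ℕ) - i) (n := n + 1) (by omega) (by omega)
  refine hu ?_
  rw [mem_accepts, hc, hcycle]
  exact hB _ hx

/-! ### Size and shape of acyclic DFAs -/

section Acyclic

variable {α : Type u} {Q : Type v} {A : DFA α Q}

theorem IsSink.evalFrom_eq {q : Q} (hq : A.IsSink q) (v : List α) : A.evalFrom q v = q := by
  induction v with
  | nil => rfl
  | cons a v ih => rw [evalFrom_cons, hq a, ih]

/-- A state from which some word is accepted does not lie on a cycle. -/
theorem IsAcyclic.evalFrom_ne (hA : A.IsAcyclic) {q : Q} {v : List α}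
    (hv : A.evalFrom q v ∈ A.accept) {y : List α} (hy : y ≠ []) : A.evalFrom q y ≠ q := by
  intro h
  obtain ⟨h1, h2⟩ := hA q y hy h
  rw [h1.evalFrom_eq] at hv
  exact h2 hv

theorem IsAcyclic.eval_take_ne (hA : A.IsAcyclic) {w : List α} {i j : ℕ} (hij : i < j)
    (hj : j ≤ w.length) {v : List α} (hv : A.evalFrom (A.eval (w.take i)) v ∈ A.accept) :
    A.eval (w.take i) ≠ A.eval (w.take j) := by
  intro h
  refine hA.evalFrom_ne hv (y := (w.drop i).take (j - i)) ?_ ?_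
  · intro h0
    have := congrArg List.length h0
    simp only [List.length_take, List.length_drop, List.length_nil] at this
    omega
  · have h1 : w.take i ++ (w.drop i).take (j - i) = w.take j := by
      rw [← List.take_add]
      congr 1
      omega
    have h2 : A.eval (w.take i ++ (w.drop i).take (j - i)) =
        A.evalFrom (A.eval (w.take i)) ((w.drop i).take (j - i)) := evalFrom_append _ _ _ _
    rw [← h2, h1, h]

theorem evalFrom_eval_drop (A : DFA α Q) (w : List α) (i : ℕ) :
    A.evalFrom (A.eval (w.take i)) (w.drop i) = A.eval w := by
  have h : A.eval (w.take i ++ w.drop i) = A.evalFrom (A.eval (w.take i)) (w.drop i) :=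
    evalFrom_append _ _ _ _
  rw [← h, List.take_append_drop]

theorem IsAcyclic.exists_isLongestLength [Fintype Q] (hA : A.IsAcyclic)
    (hne : ∃ w : List α, w ∈ A.accepts) : ∃ n : ℕ, A.IsLongestLength n := by
  have hb : BddAbove {m : ℕ | ∃ w : List α, w ∈ A.accepts ∧ w.length = m} := by
    refine ⟨Fintype.card Q, ?_⟩
    rintro _ ⟨w, hw, rfl⟩
    have hinj : Function.Injective
        (fun i : Fin (w.length + 1) => A.eval (w.take i)) := by
      intro i j hij
      by_contra hne
      have hlive : ∀ k, A.evalFrom (A.eval (w.take k)) (w.drop k) ∈ A.accept := by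
        intro k
        rw [evalFrom_eval_drop]
        exact hw
      rcases lt_or_gt_of_ne hne with h | h
      · exact hA.eval_take_ne h (by omega) (hlive i) hij
      · exact hA.eval_take_ne h (by omega) (hlive j) hij.symm
    have := Fintype.card_le_of_injective _ hinj
    rw [Fintype.card_fin] at this
    omega
  obtain ⟨w, hw⟩ := hne
  have hn : {m : ℕ | ∃ w : List α, w ∈ A.accepts ∧ w.length = m}.Nonempty := ⟨_, w, hw, rfl⟩
  exact ⟨_, Nat.sSup_mem hn hb, fun m hm => le_csSup hb hm⟩

theorem IsLongestLength.length_le {n : ℕ} (h : A.IsLongestLength n) {w : List α}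
    (hw : w ∈ A.accepts) : w.length ≤ n :=
  h.2 ⟨w, hw, rfl⟩

/-- The states along a word `w` of maximal length, and one further state, are distinct. -/
theorem IsAcyclic.injective_eval_take (hA : A.IsAcyclic) {w : List α}
    (hw : w ∈ A.accepts) (a : α) :
    Function.Injective (fun i : Fin (w.length + 2) => A.eval ((w ++ [a]).take i)) := by
  have hlive : ∀ k ≤ w.length,
      A.evalFrom (A.eval ((w ++ [a]).take k)) (w.drop k) ∈ A.accept := by
    intro k hk
    rw [List.take_append_of_le_length hk, evalFrom_eval_drop]
    exact hw
  intro i j hij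
  by_contra hne
  rcases lt_or_gt_of_ne hne with h | h
  · exact hA.eval_take_ne h (by simp; omega) (hlive i (by omega)) hij
  · exact hA.eval_take_ne h (by simp; omega) (hlive j (by omega)) hij.symm

theorem IsAcyclic.add_two_le_card [Fintype Q] [Nonempty α] (hA : A.IsAcyclic) {n : ℕ}
    (hn : A.IsLongestLength n) : n + 2 ≤ Fintype.card Q := by
  obtain ⟨w, hw, rfl⟩ := hn.1
  have := Fintype.card_le_of_injective _ (hA.injective_eval_take hw (Classical.arbitrary α))
  rwa [Fintype.card_fin] at this

/-- The states along a longest word and one further letter exhaust `Q`; numbering them by position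
gives the ladder. A step that does not climb would close a cycle through a live state. -/
theorem IsAcyclic.isLinear_and_exists_isLadder [Fintype Q] [Nonempty α] (hA : A.IsAcyclic)
    {n : ℕ} (hn : A.IsLongestLength n) (hcard : Fintype.card Q = n + 2) :
    A.IsLinear ∧ ∃ M : DFA α ℕ, M.IsLadder n ∧ M.accepts = A.accepts := by
  obtain ⟨w, hw, rfl⟩ := hn.1
  let a := Classical.arbitrary α
  have hbij : Function.Bijective
      (fun i : Fin (w.length + 2) => A.eval ((w ++ [a]).take i)) :=
    (Fintype.bijective_iff_injective_and_card _).2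
      ⟨hA.injective_eval_take hw a, by rw [Fintype.card_fin, hcard]⟩
  let e : Fin (w.length + 2) ≃ Q := Equiv.ofBijective _ hbij
  have he : ∀ i, e i = A.eval ((w ++ [a]).take i) := fun _ => rfl
  have hlive : ∀ i : Fin (w.length + 2), (i : ℕ) ≤ w.length →
      A.evalFrom (e i) (w.drop i) ∈ A.accept := by
    intro k hk
    rw [he, List.take_append_of_le_length hk, evalFrom_eval_drop]
    exact hw
  have hreach : ∀ i j : Fin (w.length + 2), i ≤ j → ∃ v, A.evalFrom (e i) v = e j := by
    intro i j hij
    refine ⟨((w ++ [a]).take j).drop i, ?_⟩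
    have h := evalFrom_eval_drop A ((w ++ [a]).take j) i
    rw [List.take_take, min_eq_left (Fin.le_def.1 hij)] at h
    exact h
  have hback : ∀ i j : Fin (w.length + 2), i ≤ j → (i : ℕ) ≤ w.length → ∀ v, v ≠ [] →
      A.evalFrom (e j) v ≠ e i := by
    intro i j hij hi v hv heq
    obtain ⟨y, hy⟩ := hreach i j hij
    refine hA.evalFrom_ne (hlive i hi) (y := y ++ v) (by simp [hv]) ?_
    rw [evalFrom_append, hy, heq]
  have hlt : ∀ i j : Fin (w.length + 2), i < j →
      Xor (A.ReachableFrom (e i) (e j)) (A.ReachableFrom (e j) (e i)) := by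
    intro i j hij
    refine Or.inl ⟨hreach i j hij.le, ?_⟩
    rintro ⟨v, hv⟩
    refine hback i j hij.le (by have := j.2; have : (i : ℕ) < j := hij; omega) v ?_ hv
    rintro rfl
    exact hij.ne' (e.injective hv)
  refine ⟨fun q q' hq => ?_, ?_⟩
  · obtain ⟨i, rfl⟩ := e.surjective q
    obtain ⟨j, rfl⟩ := e.surjective q'
    rcases lt_or_gt_of_ne (fun h : i = j => hq (congrArg e h)) with h | h
    · exact hlt i j h
    · exact (hlt j i h).symm
  · let M : DFA α ℕ :=
      { step := fun t y =>
          if h : t < w.length + 2 then e.symm (A.step (e ⟨t, h⟩) y) else w.length + 1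
        start := 0
        accept := {t | ∃ h : t < w.length + 2, e ⟨t, h⟩ ∈ A.accept} }
    have hM : ∀ v : List α, M.eval v = e.symm (A.eval v) := by
      intro v
      induction v using List.reverseRecOn with
      | nil =>
        have : e.symm A.start = 0 := by
          rw [Equiv.symm_apply_eq]
          rfl
        simp [this, M]
      | append_singleton v y ih =>
        rw [eval_append_singleton, eval_append_singleton, ih]
        simp [M]
    have hstep : ∀ (t : Fin (w.length + 2)) y, M.step t y = e.symm (A.step (e t) y) := by
      intro t y
      simp [M]
    refine ⟨M, ⟨rfl, ?_, ?_, ?_, ?_, ?_⟩, ?_⟩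
    · intro t ht y
      have h1 := hstep ⟨t, by omega⟩ y
      dsimp only at h1
      rw [h1]
      by_contra! hle
      refine hback (e.symm (A.step (e ⟨t, by omega⟩) y)) ⟨t, by omega⟩ hle (by omega) [y]
        (by simp) ?_
      simp
    · intro t y
      simp only [M]
      split_ifs
      · omega
      · rfl
    · intro y
      have h1 := hstep ⟨w.length + 1, by omega⟩ y
      dsimp only at h1
      rw [h1]
      by_contra hne
      refine hback (e.symm (A.step (e ⟨w.length + 1, by omega⟩) y)) ⟨w.length + 1, by omega⟩
        (Fin.mk_le_mk.2 (by omega) : _) (by omega) [y] (by simp) ?_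
      simp
    · refine ⟨by omega, ?_⟩
      have := hlive ⟨w.length, by omega⟩ le_rfl
      simpa using this
    · rintro ⟨h, hacc⟩
      rw [he] at hacc
      have h1 : (w ++ [a]).take (w.length + 1) = w ++ [a] :=
        List.take_of_length_le (by simp)
      dsimp only at hacc
      rw [h1] at hacc
      have := hn.length_le (w := w ++ [a]) hacc
      simp at this
    · ext v
      rw [mem_accepts, mem_accepts, hM]
      simp [M]

end Acyclic

/-! ### Minimal linear DFAs have at most `n + 2` states -/

section Minimal

variable {α : Type u} {Q : Type v} {A : DFA α Q}

theorem IsMinimal.index_eq [Fintype Q] (hA : A.IsMinimal) :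
    index A.accepts = Fintype.card Q := by
  refine le_antisymm (Nat.sInf_le (exists_fin_accepts_eq A)) ?_
  refine le_csInf ⟨_, exists_fin_accepts_eq A⟩ ?_
  rintro m ⟨B, hB⟩
  by_contra! hlt
  exact hA m B hlt hB

open Classical in
/-- A map from the states of a minimal DFA that is compatible with transitions and acceptance on the
reachable states needs at least as many values as there are states. -/
theorem IsMinimal.card_le [Fintype Q] (hA : A.IsMinimal) {m : ℕ} (φ : Q → Fin m)
    (hstep : ∀ (x y : List α) (a : α), φ (A.eval x) = φ (A.eval y) →
      φ (A.step (A.eval x) a) = φ (A.step (A.eval y) a))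
    (hacc : ∀ x y : List α, φ (A.eval x) = φ (A.eval y) → A.eval x ∈ A.accept →
      A.eval y ∈ A.accept) :
    Fintype.card Q ≤ m := by
  by_contra! hlt
  let B : DFA α (Fin m) :=
    { step := fun q a =>
        if h : ∃ x, φ (A.eval x) = q then φ (A.step (A.eval h.choose) a) else q
      start := φ A.start
      accept := {q | ∃ x, φ (A.eval x) = q ∧ A.eval x ∈ A.accept} }
  have hB : ∀ v : List α, B.eval v = φ (A.eval v) := by
    intro v
    induction v using List.reverseRecOn with
    | nil => rfl
    | append_singleton v y ih =>
      rw [eval_append_singleton, eval_append_singleton, ih]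
      have h : ∃ x, φ (A.eval x) = φ (A.eval v) := ⟨v, rfl⟩
      simp only [B]
      rw [dif_pos h]
      exact hstep _ _ y h.choose_spec
  refine hA m B hlt ?_
  ext v
  rw [mem_accepts, mem_accepts, hB]
  constructor
  · rintro ⟨x, hx, hx'⟩
    exact hacc x v hx hx'
  · exact fun hv => ⟨v, rfl, hv⟩

-- Send a live state to the length of the longest word accepted from it, and all dead states to `n +
-- 1`. This length drops strictly along reachability, so by linearity it distinguishes the reachable
-- live states.
open Classical in
theorem IsMinimal.card_le_of_isLinear [Fintype Q] (hA : A.IsMinimal) (hlin : A.IsLinear) {n : ℕ}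
    (hn : A.IsLongestLength n) : Fintype.card Q ≤ n + 2 := by
  let P : Q → ℕ → Prop := fun q k => ∃ v : List α, v.length = k ∧ A.evalFrom q v ∈ A.accept
  let H : Q → ℕ := fun q => Nat.findGreatest (P q) n
  have hP : ∀ (x : List α) (k : ℕ), P (A.eval x) k → k ≤ n := by
    rintro x _ ⟨v, rfl, hv⟩
    have h1 := hn.length_le (w := x ++ v) (by
      change A.evalFrom A.start (x ++ v) ∈ A.accept
      rw [evalFrom_append]
      exact hv)
    rw [List.length_append] at h1
    omega
  have hH : ∀ (x : List α), (∃ k, P (A.eval x) k) → P (A.eval x) (H (A.eval x)) := by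
    rintro x ⟨k, hk⟩
    exact Nat.findGreatest_spec (hP x k hk) hk
  have hlt : ∀ x y : List α, (∃ k, P (A.eval y) k) → A.eval x ≠ A.eval y →
      A.ReachableFrom (A.eval x) (A.eval y) → H (A.eval y) < H (A.eval x) := by
    rintro x y hy hne ⟨v, hv⟩
    obtain ⟨z, hz, hacc⟩ := hH y hy
    have h1 : P (A.eval x) (v.length + z.length) :=
      ⟨v ++ z, List.length_append, by rw [evalFrom_append, hv]; exact hacc⟩
    have h2 : v.length + z.length ≤ H (A.eval x) := Nat.le_findGreatest (hP x _ h1) h1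
    have h3 : v ≠ [] := by
      rintro rfl
      exact hne hv
    have := List.length_pos_iff.2 h3
    omega
  let φ : Q → Fin (n + 2) := fun q =>
    if ∃ k, P q k then ⟨H q, Nat.lt_succ_of_le ((Nat.findGreatest_le n).trans n.le_succ)⟩
    else ⟨n + 1, by omega⟩
  have hφ : ∀ x y : List α, φ (A.eval x) = φ (A.eval y) → A.eval x = A.eval y ∨
      (¬ (∃ k, P (A.eval x) k) ∧ ¬ (∃ k, P (A.eval y) k)) := by
    intro x y hxy
    have h1 : H (A.eval x) ≤ n := Nat.findGreatest_le n
    have h2 : H (A.eval y) ≤ n := Nat.findGreatest_le n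
    by_cases hx : ∃ k, P (A.eval x) k
    · by_cases hy : ∃ k, P (A.eval y) k
      · left
        simp only [φ, hx, hy, if_true, Fin.mk.injEq] at hxy
        by_contra hne
        rcases hlin _ _ hne with h | h
        · have := hlt x y hy hne h.1
          omega
        · have := hlt y x hx (Ne.symm hne) h.1
          omega
      · simp only [φ, hx, hy, if_true, if_false, Fin.mk.injEq] at hxy
        omega
    · by_cases hy : ∃ k, P (A.eval y) k
      · simp only [φ, hx, hy, if_true, if_false, Fin.mk.injEq] at hxy
        omega
      · exact Or.inr ⟨hx, hy⟩
  refine hA.card_le φ (fun x y a hxy => ?_) (fun x y hxy hx => ?_)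
  · rcases hφ x y hxy with h | ⟨hx, hy⟩
    · rw [h]
    · have hdead : ∀ z : List α, ¬ (∃ k, P (A.eval z) k) →
          ¬ (∃ k, P (A.step (A.eval z) a) k) := by
        rintro z hz ⟨k, v, hv, hacc⟩
        exact hz ⟨_, a :: v, rfl, hacc⟩
      simp only [φ, if_neg (hdead x hx), if_neg (hdead y hy)]
  · rcases hφ x y hxy with h | ⟨h, -⟩
    · rwa [← h]
    · exact absurd ⟨0, [], rfl, hx⟩ h

end Minimal

/-! ### Separable and inseparable words of ladders -/

namespace IsLadder

variable {α : Type u} {M : DFA α ℕ} {n : ℕ}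

/-- In a safety ladder, all proper states are accepting. -/
theorem mem_accepts_of_eval_le (h : M.IsLadder n) (hsafe : M.IsSafety) {w : List α}
    (hw : w ∈ M.accepts) (hl : w.length = n) {v : List α} (hv : M.eval v ≤ n) :
    v ∈ M.accepts := by
  by_contra hv'
  refine hsafe v hv' (w.drop (M.eval v)) ?_
  rw [mem_accepts, eval_append, h.evalFrom_drop hw hl hv]
  exact h.mem_accept

/-- If every compression of the longest word `w ++ [c]` has an accepted extension, then
`w ++ [c, c]` cannot be separated from the language by a small DFA. -/
theorem not_separable_of_isCompression (h : M.IsLadder n) (hsafe : M.IsSafety) {w : List α}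
    {c : α} (hw : w ++ [c] ∈ M.accepts) (hl : (w ++ [c]).length = n)
    (hc : ∀ w', IsCompression (w ++ [c]) w' → ∃ v : List α, v ≠ [] ∧ w' ++ v ∈ M.accepts) :
    ¬ Separable M.accepts (n + 1) (w ++ [c] ++ [c]) := by
  have hlw : w.length + 1 = n := by simpa using hl
  have hlt : ∀ w', IsCompression (w ++ [c]) w' → M.eval w' < n := by
    intro w' hw'
    obtain ⟨v, hv, hacc⟩ := hc w' hw'
    have h1 := h.eval_le_of_mem hacc
    rw [eval_append] at h1
    have h2 := h.add_length_le (h.eval_le _) h1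
    have := List.length_pos_iff.2 hv
    omega
  -- For `t < n - 1`, the first `t` letters followed by `c` form a compression, since compressions
  -- keep the last letter.
  have hstep : ∀ t < n, M.step t c ≤ n := by
    intro t ht
    have h1 := h.eval_take hw hl ht.le
    rcases Nat.lt_or_ge t (n - 1) with htn | htn
    · have h2 := hlt ((w ++ [c]).take t ++ [c]) ⟨t, n - t, by omega, by omega, by
        rw [show t + (n - t) - 1 = w.length by omega, List.drop_left]⟩
      rw [eval_append_singleton, h1] at h2
      exact h2.le
    · have h2 := h.step_getElem hw hl ht
      obtain rfl : t = w.length := by omega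
      rw [List.getElem_concat_length rfl] at h2
      omega
  have hmem : ∀ v, M.eval v < n → v ++ [c] ∈ M.accepts := by
    intro v hv
    refine h.mem_accepts_of_eval_le hsafe hw hl ?_
    rw [eval_append_singleton]
    exact hstep _ hv
  rintro ⟨m, hm, B, hB, hu⟩
  have hpre : ∀ k ≤ n, B.eval ((w ++ [c]).take k) ∈ B.accept := by
    intro k hk
    refine hB _ (h.mem_accepts_of_eval_le hsafe hw hl ?_)
    rw [h.eval_take hw hl hk]
    exact hk
  -- Pigeonhole on the `n + 1` prefixes of `wc` together with `wcc`, encoded as `none`. The latter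
  -- is rejected and the prefixes are accepted, so two prefixes collide.
  obtain ⟨i, j, hij, hj, heq⟩ : ∃ i j : ℕ, i < j ∧ j ≤ n ∧
      B.eval ((w ++ [c]).take i) = B.eval ((w ++ [c]).take j) := by
    obtain ⟨i, j, hij, heq⟩ := Fintype.exists_ne_map_eq_of_card_lt
      (fun i : Option (Fin (n + 1)) =>
        i.elim (B.eval (w ++ [c] ++ [c])) (fun i => B.eval ((w ++ [c]).take i)))
      (by simp; omega)
    rcases i with _ | i <;> rcases j with _ | j
    · exact absurd rfl hij
    · exact absurd ((congrArg (· ∈ B.accept) heq).mpr (hpre j (by omega))) hu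
    · exact absurd ((congrArg (· ∈ B.accept) heq).mp (hpre i (by omega))) hu
    · have hne : i ≠ j := fun h => hij (congrArg some h)
      rcases lt_or_gt_of_ne hne with h | h
      · exact ⟨i, j, h, by omega, heq⟩
      · exact ⟨j, i, h, by omega, heq.symm⟩
  have hB' : B.eval ((w ++ [c]).take i ++ (w ++ [c]).drop j) = B.eval (w ++ [c]) := by
    rw [← evalFrom_eval_drop B (w ++ [c]) j, ← heq]
    exact evalFrom_append _ _ _ _
  -- Cutting out the loop leaves a compression if `j < n` and a proper prefix if `j = n`. Appending
  -- `c` then gives an accepted word which `B` cannot tell from `wcc`.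
  have hv : M.eval ((w ++ [c]).take i ++ (w ++ [c]).drop j) < n := by
    rcases hj.lt_or_eq with hj | rfl
    · exact hlt _ ⟨i, j - i + 1, by omega, by omega, by
        rw [show i + (j - i + 1) - 1 = j by omega]⟩
    · rw [List.drop_of_length_le hl.le, List.append_nil, h.eval_take hw hl hij.le]
      exact hij
  have h1 := hB _ (hmem _ hv)
  rw [mem_accepts, eval_append_singleton, hB', ← eval_append_singleton] at h1
  exact hu h1

theorem separable (h : M.IsLadder n) (hne : ∃ w ∈ M.accepts, w.length = n)
    (hpow : ∀ x : α, List.replicate n x ∉ M.accepts) (hM : ¬ M.IsSafety ∨ M.HasCEP)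
    {u : List α} (hu : u ∉ M.accepts) : Separable M.accepts (n + 1) u := by
  rcases Nat.lt_or_ge u.length n with hlt | hge
  · exact separable_of_length_le (by omega) hu
  by_cases hsub : ∀ p : List α, p.Sublist u → p.length = n → p ∈ M.accepts
  · rcases hge.eq_or_lt with heq | hgt
    · exact absurd (hsub u (List.Sublist.refl u) heq.symm) hu
    rcases hM with hM | hM
    · simp only [IsSafety, not_forall, not_not] at hM
      obtain ⟨v, hv, y, hy⟩ := hM
      have h1 := h.eval_prefix_le (h.eval_le_of_mem hy)
      have h2 : M.eval v ≠ n := fun h2 => hv (by rw [mem_accepts, h2]; exact h.mem_accept)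
      exact h.separable_of_forall_sublist (s := M.eval v) hv (by omega) hpow hgt hsub
    · have hl : (u.take n).length = n := by rw [List.length_take]; omega
      have hw := hsub _ (List.take_sublist n u) hl
      have hlong : M.IsLongestLength n :=
        ⟨⟨_, hw, hl⟩, by rintro _ ⟨v, hv, rfl⟩; exact h.length_le hv⟩
      obtain ⟨w', hc, hv⟩ := hM n hlong _ hw hl
      rw [← List.take_append_drop n u]
      exact h.separable_of_isCompression hw hl hc hv (by simpa using hgt)
  · push Not at hsub
    obtain ⟨p, hpu, hpl, hp⟩ := hsub
    refine separable_of_sublist (by omega) (fun w hw hpw => hp ?_) hpu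
    rwa [hpw.eq_of_length_le (by rw [hpl]; exact h.length_le hw)]

end IsLadder

theorem isSafety_congr {α : Type u} {Q : Type v} {S : Type*} {A : DFA α Q} {M : DFA α S}
    (h : M.accepts = A.accepts) : M.IsSafety ↔ A.IsSafety := by
  unfold IsSafety
  rw [h]

theorem hasCEP_congr {α : Type u} {Q : Type v} {S : Type*} {A : DFA α Q} {M : DFA α S}
    (h : M.accepts = A.accepts) : M.HasCEP ↔ A.HasCEP := by
  unfold HasCEP IsLongestLength
  rw [h]

end DFA

/-! ### The characterization -/

theorem mainTheorem1 {α : Type*} {Q : Type*} [Finite α] [Nonempty α] [Fintype Q]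
    (A : DFA α Q) (hmin : A.IsMinimal) (hacyc : A.IsAcyclic) (hne : ∃ w : List α, w ∈ A.accepts) :
    ∃ n : ℕ, A.IsLongestLength n ∧
      (A.IsPrime ↔
        A.IsLinear ∧
          ((∃ a : α, List.replicate n a ∈ A.accepts) ∨ (A.IsSafety ∧ ¬ A.HasCEP))) := by
  obtain ⟨n, hn⟩ := hacyc.exists_isLongestLength hne
  refine ⟨n, hn, ?_⟩
  have hcard := hacyc.add_two_le_card hn
  unfold DFA.IsPrime DFA.IsComposite
  rw [hmin.index_eq]
  rcases hcard.eq_or_lt with heq | hgt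
  · obtain ⟨hlin, M, hM, hacc⟩ := hacyc.isLinear_and_exists_isLadder hn heq.symm
    have hprime : ∀ u : List α, u ∉ A.accepts → ¬ DFA.Separable A.accepts (n + 1) u →
        ¬ ∃ k, 1 ≤ k ∧ k < Fintype.card Q ∧ A.IsDecomposable k := by
      rintro u hu hsep ⟨k, -, hk, hdec⟩
      exact hsep ((DFA.separable_of_isDecomposable hdec hu).mono (by omega))
    constructor
    · intro hp
      refine ⟨hlin, ?_⟩
      by_contra! hcon
      refine hp ⟨n + 1, by omega, by omega, DFA.isDecomposable_of_separable A (by omega) ?_⟩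
      intro u hu
      rw [← hacc] at hu ⊢
      refine hM.separable (by rw [hacc]; exact hn.1) (by rw [hacc]; exact hcon.1) ?_ hu
      rw [DFA.isSafety_congr hacc, DFA.hasCEP_congr hacc]
      by_cases hs : A.IsSafety
      · exact Or.inr (hcon.2 hs)
      · exact Or.inl hs
    · rintro ⟨-, hcond⟩
      have hpow : (∃ a : α, List.replicate n a ∈ A.accepts) →
          ¬ ∃ k, 1 ≤ k ∧ k < Fintype.card Q ∧ A.IsDecomposable k := by
        rintro ⟨a, ha⟩
        refine hprime _ (fun hu => ?_) (DFA.not_separable_replicate ha)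
        have h1 := hn.length_le hu
        have h2 := Nat.factorial_pos (n + 1)
        rw [List.length_replicate] at h1
        omega
      rcases hcond with ha | ⟨hsafe, hcep⟩
      · exact hpow ha
      · simp only [DFA.HasCEP, not_forall, not_exists, not_and] at hcep
        obtain ⟨n', hn', w, hw, hl, hc⟩ := hcep
        obtain rfl : n = n' := hn.unique hn'
        rcases List.eq_nil_or_concat w with rfl | ⟨w, c, rfl⟩
        -- Here `n = 0`, and the empty word is the zeroth power of any letter.
        · exact hpow ⟨Classical.arbitrary α, by rw [← hl]; exact hw⟩
        · rw [List.concat_eq_append] at hw hl hc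
          refine hprime (w ++ [c] ++ [c]) (fun hu => ?_) ?_
          · have h1 := hn.length_le hu
            rw [List.length_append, hl] at h1
            simp at h1
          · rw [← hacc]
            refine hM.not_separable_of_isCompression ((DFA.isSafety_congr hacc).2 hsafe)
              (by rw [hacc]; exact hw) hl (fun w' hw' => ?_)
            have h1 := hc w' hw'
            push Not at h1
            obtain ⟨v, hv, hv'⟩ := h1
            exact ⟨v, hv, by rwa [hacc]⟩
  · constructor
    · intro hp
      -- Now `n + 2` states are allowed: enough to forbid a subsequence of length `n + 1`, or a
      -- single word of length at most `n`.
      refine absurd ⟨Fintype.card Q - 1, by omega, by omega,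
        DFA.isDecomposable_of_separable A (by omega) ?_⟩ hp
      intro u hu
      rcases Nat.lt_or_ge n u.length with hlt | hge
      · have hl : (u.take (n + 1)).length = n + 1 := by rw [List.length_take]; omega
        refine DFA.separable_of_sublist (p := u.take (n + 1)) (by omega) (fun w hw hs => ?_)
          (List.take_sublist _ _)
        have h1 := hs.length_le
        have h2 := hn.length_le hw
        omega
      · exact DFA.separable_of_length_le (by omega) hu
    · rintro ⟨hlin, -⟩
      have := hmin.card_le_of_isLinear hlin hn
      omega
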